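/- Let $\mathbb T^2=\mathbb R^2/\mathbb Z^2$ be the flat torus with the quotient Euclidean distance and let $\bar B(x_0,r_0)$ denote its closed balls. Let $\tau>0$, $M>0$, $x_0\in\mathbb T^2$ and $r_0>0$. Then there exists $U\in\mathscr C^\infty([0,\tau]\times\mathbb T^2;\mathbb R^2)$ such that (i) $\operatorname{curl}_xU(t,x)=\partial_1U_2(t,x)-\partial_2U_1(t,x)=0$ for all $(t,x)\in[0,\tau]\times(\mathbb T^2\setminus\bar B(x_0,r_0))$; (ii) $\operatorname{supp}U\subset(0,\tau)\times\mathbb T^2$, where the support is the closure of $\{U\neq0\}$ in $[0,\tau]\times\mathbb T^2$; (iii) $\int_{\mathbb T^2}U(t,x)\,dx=0$ for all $t\in[0,\tau]$; and there exists $\bar M>0$ such that, for every $(x,v)\in\mathbb T^2\times\mathbb R^2$ with $|v|<M$, the characteristic system of the field $-v+U$, $$X'(t)=V(t),\qquad V'(t)=-V(t)+U(t,X(t)),\qquad X(0)=x,\quad V(0)=v,$$ has a solution on $[0,\tau]$, and for every such solution there is $t\in(0,\tau)$ with $$M+1\le|V(t)|<\bar M .$$ -/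

import Mathlib

open Set MeasureTheory
open scoped ContDiff

namespace LowVelocities

/-- The Euclidean plane `ℝ²`. -/
abbrev Plane : Type := EuclideanSpace ℝ (Fin 2)

/-- The integer lattice `ℤ²` in `ℝ²`. -/
def integerLattice : AddSubgroup Plane where
  carrier := {y | ∀ i, ∃ n : ℤ, y i = n}
  zero_mem' := fun _ => ⟨0, by simp⟩
  add_mem' := by
    intro a b ha hb i
    obtain ⟨m, hm⟩ := ha i
    obtain ⟨n, hn⟩ := hb i
    exact ⟨m + n, by simp [hm, hn]⟩
  neg_mem' := by
    intro a ha i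
    obtain ⟨m, hm⟩ := ha i
    exact ⟨-m, by simp [hm]⟩

/-- The flat torus `𝕋² = ℝ² / ℤ²`. Its distance is the quotient of the Euclidean one,
`d(x, y) = min {|a - b| : a ∈ x, b ∈ y}`. The coercion `Plane → Torus` is the projection. -/
abbrev Torus : Type := Plane ⧸ integerLattice

/-- `U ∈ 𝒞^∞([0,τ] × 𝕋²; ℝ²)`: the `ℤ²`-periodic lift of `U` is smooth on `[0,τ] × ℝ²`. -/
def SmoothField (τ : ℝ) (U : ℝ → Torus → Plane) : Prop :=
  ContDiffOn ℝ ∞ (fun p : ℝ × Plane => U p.1 (p.2 : Torus)) (Icc 0 τ ×ˢ univ)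

/-- `curl W = ∂₁ W₂ - ∂₂ W₁` of a field `W` on the torus, at the point of the torus that is
represented by `y`. -/
noncomputable def curl (W : Torus → Plane) (y : Plane) : ℝ :=
  fderiv ℝ (fun z : Plane => W (z : Torus)) y (EuclideanSpace.single 0 1) 1
    - fderiv ℝ (fun z : Plane => W (z : Torus)) y (EuclideanSpace.single 1 1) 0

/-- The support of `U` in `[0,τ] × 𝕋²`. -/
def spaceTimeSupport (τ : ℝ) (U : ℝ → Torus → Plane) : Set (ℝ × Torus) :=
  closure {p | p.1 ∈ Icc 0 τ ∧ U p.1 p.2 ≠ 0}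

/-- `∫_{𝕋²} W dx`, where `dx` is Lebesgue measure of total mass one, computed on the fundamental
domain `[0,1)²`. -/
noncomputable def torusIntegral (W : Torus → Plane) : Plane :=
  ∫ y in {y : Plane | ∀ i, y i ∈ Ico (0 : ℝ) 1}, W (y : Torus)

/-- `(X, V)` is, on the time interval `[0,τ]`, the characteristic of the field `-v + U` starting
at time `0` from `(x, v)`: `X' = V`, `V' = -V + U(t, X)`, `X(0) = x`, `V(0) = v`. The derivative
of the curve `X` in the torus is the derivative of a lift of `X` to `ℝ²`. -/
def IsCharacteristic (τ : ℝ) (U : ℝ → Torus → Plane) (x : Torus) (v : Plane)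
    (X : ℝ → Torus) (V : ℝ → Plane) : Prop :=
  X 0 = x ∧ V 0 = v ∧
  (∃ Y : ℝ → Plane, ∀ t ∈ Icc 0 τ,
    (Y t : Torus) = X t ∧ HasDerivWithinAt Y (V t) (Icc 0 τ) t) ∧
  ∀ t ∈ Icc 0 τ, HasDerivWithinAt V (-V t + U t (X t)) (Icc 0 τ) t

end LowVelocities

namespace LowVelocities

/-! ### Periodic maps on the plane -/

/-! A strong and very short impulse accelerates every slow particle at once, provided the spatial
profile never vanishes. The field is `U(t, x) = e^{-t} A Φ'(t) f(x)`, with `Φ` a smooth step rising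
from 0 to 1 before time `T`. The integrating factor removes the damping: `(e^t V)' = A Φ'(t) f(X)`.
If `T` is small, `X` hardly moves, so `e^T V(T)` is close to `v + A f(x)`. Since `|f| ≥ m > 0`, a
large `A` gives `|V(T)| ≥ M + 1`; this estimate is `le_norm_exp_smul_of_impulse`.

The profile (`exists_nonvanishing_field`) must be curl-free outside the ball, have mean zero and
vanish nowhere. The constant field `e₁` lacks only mean zero. It is corrected inside the ball to `(1
- h² / J, h)`, where `h` is supported there, `∫ h = 0` and `J = ∫ h² > 0`. Both means are zero, and
the components have no common zero, because the first is 1 wherever `h = 0`. -/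

theorem coe_eq_coe_iff {y z : Plane} : (y : Torus) = z ↔ z - y ∈ integerLattice := by
  rw [QuotientAddGroup.eq, neg_add_eq_sub]

/-- The map induced on the torus by a lattice-periodic map on the plane. -/
def descend {E : Type*} (f : Plane → E) (hf : ∀ y, ∀ z ∈ integerLattice, f (y + z) = f y) :
    Torus → E :=
  fun q => Quotient.liftOn' q f fun y z h => by
    have h' := QuotientAddGroup.leftRel_apply.mp h
    have := hf y _ h'
    rw [add_neg_cancel_left] at this
    exact this.symm

theorem descend_coe {E : Type*} (f : Plane → E)
    (hf : ∀ y, ∀ z ∈ integerLattice, f (y + z) = f y) (y : Plane) :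
    descend f hf (y : Torus) = f y := rfl

theorem exists_bound_of_continuous_of_periodic {E : Type*} [NormedAddCommGroup E] {f : Plane → E}
    (hc : Continuous f) (hf : ∀ y, ∀ z ∈ integerLattice, f (y + z) = f y) :
    ∃ B : ℝ, 0 < B ∧ ∀ y, ‖f y‖ ≤ B := by
  obtain ⟨C, hC⟩ := (isCompact_closedBall (0 : Plane) 2).exists_bound_of_continuousOn
    hc.continuousOn
  refine ⟨max C 1, by positivity, fun y => ?_⟩
  let z : Plane := WithLp.toLp 2 fun i => -(⌊y i⌋ : ℝ)
  have hz : z ∈ integerLattice := fun i => ⟨-⌊y i⌋, by simp [z]⟩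
  rw [← hf y z hz]
  refine (hC _ ?_).trans (le_max_left _ _)
  rw [mem_closedBall_zero_iff, EuclideanSpace.norm_eq]
  apply Real.sqrt_le_iff.mpr
  refine ⟨by norm_num, ?_⟩
  have key : ∀ i, ‖(y + z) i‖ ^ 2 ≤ 1 := fun i => by
    have h1 : (y + z) i = Int.fract (y i) := by
      simp [z, Int.fract, sub_eq_add_neg]
    rw [h1, Real.norm_eq_abs, sq_abs]
    have := Int.fract_nonneg (y i)
    have := Int.fract_lt_one (y i)
    nlinarith
  rw [Fin.sum_univ_two]
  linarith [key 0, key 1]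

theorem exists_lipschitzWith_of_periodic {f : Plane → Plane}
    (hc : ContDiff ℝ ∞ f) (hf : ∀ y, ∀ z ∈ integerLattice, f (y + z) = f y) :
    ∃ K : NNReal, LipschitzWith K f := by
  obtain ⟨B, hB, hb⟩ := exists_bound_of_continuous_of_periodic
    (f := fderiv ℝ f) (hc.continuous_fderiv (by simp)) (fun y z hz => by
      rw [← fderiv_comp_add_right]
      congr 1
      exact funext fun x => hf x z hz)
  exact ⟨⟨B, hB.le⟩, lipschitzWith_of_nnnorm_fderiv_le (hc.differentiable (by simp))
    fun x => hb x⟩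

/-! ### One-dimensional profiles -/

/-- A smooth `1`-periodic even function, positive exactly where `|sin (π u)| < δ`. -/
noncomputable def bump (δ u : ℝ) : ℝ := Real.smoothTransition (δ ^ 2 - Real.sin (Real.pi * u) ^ 2)

/-- A smooth `1`-periodic odd function supported in the support of `bump δ`. -/
noncomputable def oddBump (δ u : ℝ) : ℝ := Real.sin (2 * Real.pi * u) * bump δ u

theorem contDiff_bump (δ : ℝ) : ContDiff ℝ ∞ (bump δ) :=
  Real.smoothTransition.contDiff.comp
    (contDiff_const.sub ((Real.contDiff_sin.comp (contDiff_const.mul contDiff_id)).pow 2))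

theorem contDiff_oddBump (δ : ℝ) : ContDiff ℝ ∞ (oddBump δ) :=
  (Real.contDiff_sin.comp (contDiff_const.mul contDiff_id)).mul (contDiff_bump δ)

theorem bump_add_int (δ u : ℝ) (n : ℤ) : bump δ (u + n) = bump δ u := by
  have : Real.sin (Real.pi * (u + n)) ^ 2 = Real.sin (Real.pi * u) ^ 2 := by
    rw [Real.sin_sq_eq_half_sub, Real.sin_sq_eq_half_sub,
      show 2 * (Real.pi * (u + n)) = 2 * (Real.pi * u) + n * (2 * Real.pi) by ring,
      Real.cos_add_int_mul_two_pi]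
  simp only [bump, this]

theorem oddBump_add_int (δ u : ℝ) (n : ℤ) : oddBump δ (u + n) = oddBump δ u := by
  rw [oddBump, oddBump, bump_add_int,
    show 2 * Real.pi * (u + n) = 2 * Real.pi * u + n * (2 * Real.pi) by ring,
    Real.sin_add_int_mul_two_pi]

theorem oddBump_neg (δ u : ℝ) : oddBump δ (-u) = -oddBump δ u := by
  simp [oddBump, bump]

theorem exists_int_abs_sub_le_of_bump_ne_zero {δ u : ℝ} (hδ : 0 < δ) (h : bump δ u ≠ 0) :
    ∃ n : ℤ, |u - n| ≤ δ / 2 := by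
  refine ⟨round u, ?_⟩
  rw [← sub_add_cancel u (round u), bump_add_int] at h
  set w := u - round u with hw
  have hw2 : |w| ≤ 1 / 2 := abs_sub_round u
  have h1 : Real.sin (Real.pi * w) ^ 2 < δ ^ 2 := by
    by_contra hcon
    exact h (Real.smoothTransition.zero_of_nonpos (by linarith))
  have h2 : |Real.sin (Real.pi * w)| < δ := abs_lt_of_sq_lt_sq h1 hδ.le
  -- Jordan's inequality, available because `|π w| ≤ π / 2`; it amounts to `2 |w| ≤ |sin (π w)|`.
  have h3 : 2 / Real.pi * |Real.pi * w| ≤ |Real.sin (Real.pi * w)| := by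
    apply Real.mul_abs_le_abs_sin
    rw [abs_mul, abs_of_pos Real.pi_pos]
    nlinarith [Real.pi_pos]
  rw [abs_mul, abs_of_pos Real.pi_pos, ← mul_assoc, div_mul_cancel₀ _ Real.pi_ne_zero] at h3
  linarith

/-- The point `δ / 4` works because `π < 4` gives `sin (π δ / 4) < δ`. It also avoids the zero of
`sin (2 π u)` at the origin, so it serves for `oddBump` as well. -/
theorem bump_pos {δ : ℝ} (hδ : 0 < δ) (hδ1 : δ ≤ 1) : 0 < bump δ (δ / 4) := by
  apply Real.smoothTransition.pos_of_pos
  have h0 : 0 < Real.pi * (δ / 4) := by positivity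
  have h1 := Real.sin_lt h0
  have h2 : 0 < Real.sin (Real.pi * (δ / 4)) :=
    Real.sin_pos_of_pos_of_lt_pi h0 (by nlinarith [Real.pi_pos])
  have h3 : Real.pi * (δ / 4) < δ := by nlinarith [Real.pi_lt_four]
  nlinarith

theorem oddBump_pos {δ : ℝ} (hδ : 0 < δ) (hδ1 : δ ≤ 1) : 0 < oddBump δ (δ / 4) := by
  refine mul_pos (Real.sin_pos_of_pos_of_lt_pi (by positivity) ?_) (bump_pos hδ hδ1)
  nlinarith [Real.pi_pos]

theorem setIntegral_Ico_eq_of_periodic {g : ℝ → ℝ} (hp : Function.Periodic g 1) (a b : ℝ) :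
    ∫ u in Ico (0 : ℝ) 1, g (u - a) = ∫ u in b..b + 1, g u := by
  rw [integral_Ico_eq_integral_Ioc, ← intervalIntegral.integral_of_le zero_le_one,
    intervalIntegral.integral_comp_sub_right, ← hp.intervalIntegral_add_eq (0 - a) b]
  congr 1
  ring

theorem setIntegral_oddBump (δ a : ℝ) : ∫ u in Ico (0 : ℝ) 1, oddBump δ (u - a) = 0 := by
  rw [setIntegral_Ico_eq_of_periodic
    (fun u => by simpa using oddBump_add_int δ u 1) a (-(1 / 2))]
  -- On the symmetric period `[-1/2, 1/2]` oddness makes the integral equal to its own negative.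
  have h := intervalIntegral.integral_comp_neg (a := -(1 / 2)) (b := 1 / 2) (oddBump δ)
  simp only [oddBump_neg, intervalIntegral.integral_neg, neg_neg] at h
  norm_num at h ⊢
  linarith

theorem setIntegral_sq_pos {g : ℝ → ℝ} (hg : Continuous g) (hp : Function.Periodic g 1) (a : ℝ)
    {c : ℝ} (hc : c ∈ Icc (0 : ℝ) 1) (hgc : g c ≠ 0) :
    0 < ∫ u in Ico (0 : ℝ) 1, g (u - a) ^ 2 := by
  rw [setIntegral_Ico_eq_of_periodic (g := fun u => g u ^ 2) (fun u => by simp only [hp u]) a 0,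
    zero_add]
  exact intervalIntegral.integral_pos zero_lt_one (hg.pow 2).continuousOn
    (fun x _ => sq_nonneg _) ⟨c, hc, by positivity⟩

/-! ### A nowhere vanishing field of mean zero, constant outside a ball -/

theorem unitSquare_eq_preimage :
    {y : Plane | ∀ i, y i ∈ Ico (0 : ℝ) 1} =
      (WithLp.ofLp : Plane → Fin 2 → ℝ) ⁻¹' univ.pi fun _ => Ico (0 : ℝ) 1 := by
  ext y; simp

theorem volume_unitSquare : volume {y : Plane | ∀ i, y i ∈ Ico (0 : ℝ) 1} = 1 := by
  rw [unitSquare_eq_preimage, (PiLp.volume_preserving_ofLp (Fin 2)).measure_preimage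
    (MeasurableSet.univ_pi fun _ => measurableSet_Ico).nullMeasurableSet, Real.volume_pi_Ico]
  simp

theorem setIntegral_unitSquare_mul (f g : ℝ → ℝ) :
    ∫ y in {y : Plane | ∀ i, y i ∈ Ico (0 : ℝ) 1}, f (y 0) * g (y 1) =
      (∫ u in Ico (0 : ℝ) 1, f u) * ∫ u in Ico (0 : ℝ) 1, g u := by
  rw [unitSquare_eq_preimage, (PiLp.volume_preserving_ofLp (Fin 2)).setIntegral_preimage_emb
    (MeasurableEquiv.toLp 2 (Fin 2 → ℝ)).symm.measurableEmbedding (fun y => f (y 0) * g (y 1)),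
    volume_pi, Measure.restrict_pi_pi]
  have := integral_fintype_prod_eq_prod (𝕜 := ℝ) (ι := Fin 2) (E := fun _ => ℝ)
    (μ := fun _ => volume.restrict (Ico 0 1)) ![f, g]
  simpa [Fin.prod_univ_two] using this

theorem exists_int_of_mem {z : Plane} (hz : z ∈ integerLattice) (i : Fin 2) :
    ∃ n : ℤ, z i = n := hz i

/-- Two coordinates of size at most `r / 2` give Euclidean norm at most `r / √2`, and the quotient
norm is no larger. -/
theorem mem_closedBall_of_coord {a y : Plane} {r : ℝ} {n : Fin 2 → ℤ}
    (h : ∀ i, |y i - a i - n i| ≤ r / 2) :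
    (y : Torus) ∈ Metric.closedBall (a : Torus) r := by
  have hr : 0 ≤ r := by linarith [(abs_nonneg _).trans (h 0)]
  let z : Plane := WithLp.toLp 2 fun i => (n i : ℝ)
  have hz : z ∈ integerLattice := fun i => ⟨n i, rfl⟩
  have h1 : ((y : Torus) - (a : Torus)) = ((y - a - z : Plane) : Torus) := by
    rw [← QuotientAddGroup.mk_sub, coe_eq_coe_iff]
    simpa using hz
  rw [mem_closedBall_iff_norm, h1]
  refine QuotientAddGroup.norm_mk_le_norm.trans ?_
  rw [EuclideanSpace.norm_eq]
  refine Real.sqrt_le_iff.mpr ⟨hr, ?_⟩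
  have key : ∀ i, ‖(y - a - z) i‖ ^ 2 ≤ (r / 2) ^ 2 := fun i => by
    rw [Real.norm_eq_abs]
    exact pow_le_pow_left₀ (abs_nonneg _) (by simpa [z] using h i) 2
  rw [Fin.sum_univ_two]
  nlinarith [key 0, key 1]

theorem exists_nonvanishing_field (x₀ : Torus) (r₀ : ℝ) (hr₀ : 0 < r₀) :
    ∃ f : Plane → Plane, ContDiff ℝ ∞ f ∧ (∀ y, ∀ z ∈ integerLattice, f (y + z) = f y) ∧
      (∀ y : Plane, (y : Torus) ∉ Metric.closedBall x₀ r₀ → f y = EuclideanSpace.single 0 1) ∧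
      (∫ y in {y : Plane | ∀ i, y i ∈ Ico (0 : ℝ) 1}, f y = 0) ∧
      ∃ m : ℝ, 0 < m ∧ ∀ y, m ≤ ‖f y‖ := by
  obtain ⟨a, rfl⟩ := QuotientAddGroup.mk_surjective x₀
  -- The bound by `r₀` keeps the support of `h` in the ball; the bound by 1 is needed for positivity
  -- at `δ / 4`.
  set δ := min r₀ 1 with hδdef
  have hδ : 0 < δ := lt_min hr₀ one_pos
  have hδ1 : δ ≤ 1 := min_le_right _ _
  let h : Plane → ℝ := fun y => oddBump δ (y 0 - a 0) * bump δ (y 1 - a 1)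
  have hcoord : ∀ i : Fin 2, ContDiff ℝ ∞ fun y : Plane => y i - a i := fun i =>
    ((EuclideanSpace.proj (𝕜 := ℝ) i).contDiff).sub contDiff_const
  have hsmooth : ContDiff ℝ ∞ h :=
    ((contDiff_oddBump δ).comp (hcoord 0)).mul ((contDiff_bump δ).comp (hcoord 1))
  have hper : ∀ y, ∀ z ∈ integerLattice, h (y + z) = h y := by
    intro y z hz
    obtain ⟨m, hm⟩ := exists_int_of_mem hz 0
    obtain ⟨n, hn⟩ := exists_int_of_mem hz 1
    simp only [h, PiLp.add_apply, hm, hn, add_sub_right_comm, oddBump_add_int, bump_add_int]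
  have hsupp : ∀ y : Plane, (y : Torus) ∉ Metric.closedBall (a : Torus) r₀ → h y = 0 := by
    intro y hy
    by_contra hne
    have h1 := mul_ne_zero_iff.mp hne
    obtain ⟨m, hm⟩ := exists_int_abs_sub_le_of_bump_ne_zero hδ (mul_ne_zero_iff.mp h1.1).2
    obtain ⟨n, hn⟩ := exists_int_abs_sub_le_of_bump_ne_zero hδ h1.2
    refine hy (Metric.closedBall_subset_closedBall (min_le_left r₀ 1)
      (mem_closedBall_of_coord (n := ![m, n]) ?_))
    intro i
    fin_cases i
    · exact hm
    · exact hn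
  have hint0 : ∫ y in {y : Plane | ∀ i, y i ∈ Ico (0 : ℝ) 1}, h y = 0 := by
    rw [setIntegral_unitSquare_mul (fun u => oddBump δ (u - a 0)) (fun u => bump δ (u - a 1)),
      setIntegral_oddBump, zero_mul]
  have hcmem : δ / 4 ∈ Icc (0 : ℝ) 1 := ⟨by positivity, by linarith⟩
  have hint2 : 0 < ∫ y in {y : Plane | ∀ i, y i ∈ Ico (0 : ℝ) 1}, h y ^ 2 := by
    simp only [h, mul_pow]
    rw [setIntegral_unitSquare_mul (fun u => oddBump δ (u - a 0) ^ 2)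
      (fun u => bump δ (u - a 1) ^ 2)]
    exact mul_pos
      (setIntegral_sq_pos (contDiff_oddBump δ).continuous
        (fun u => by simpa using oddBump_add_int δ u 1) _ hcmem (oddBump_pos hδ hδ1).ne')
      (setIntegral_sq_pos (contDiff_bump δ).continuous
        (fun u => by simpa using bump_add_int δ u 1) _ hcmem (bump_pos hδ hδ1).ne')
  set J := ∫ y in {y : Plane | ∀ i, y i ∈ Ico (0 : ℝ) 1}, h y ^ 2 with hJ
  have hintegrable : ∀ {E : Type} [NormedAddCommGroup E] (g : Plane → E), Continuous g →
      (∀ y, ∀ z ∈ integerLattice, g (y + z) = g y) →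
      IntegrableOn g {y : Plane | ∀ i, y i ∈ Ico (0 : ℝ) 1} := by
    intro E _ g hg hgp
    obtain ⟨B, -, hB⟩ := exists_bound_of_continuous_of_periodic hg hgp
    have : IsFiniteMeasure (volume.restrict {y : Plane | ∀ i, y i ∈ Ico (0 : ℝ) 1}) :=
      isFiniteMeasure_restrict.mpr (by rw [volume_unitSquare]; simp)
    exact Integrable.of_bound hg.aestronglyMeasurable B (ae_of_all _ hB)
  -- The factor `J⁻¹` makes the first component have mean zero, the unit square having area one.
  let f : Plane → Plane := fun y => !₂[1 - J⁻¹ * h y ^ 2, h y]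
  have hf : ContDiff ℝ ∞ f := by
    refine contDiff_euclidean.mpr fun i => ?_
    fin_cases i
    · exact contDiff_const.sub (contDiff_const.mul (hsmooth.pow 2))
    · exact hsmooth
  have hfper : ∀ y, ∀ z ∈ integerLattice, f (y + z) = f y := fun y z hz => by
    simp only [f, hper y z hz]
  refine ⟨f, hf, hfper, ?_, ?_, ?_⟩
  · intro y hy
    ext i
    fin_cases i <;> simp [f, hsupp y hy]
  · have hproj : ∀ i : Fin 2, (∫ y in {y : Plane | ∀ i, y i ∈ Ico (0 : ℝ) 1}, f y) i =
        ∫ y in {y : Plane | ∀ i, y i ∈ Ico (0 : ℝ) 1}, f y i := fun i =>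
      ((EuclideanSpace.proj (𝕜 := ℝ) i).integral_comp_comm
        (hintegrable f hf.continuous hfper)).symm
    ext i
    rw [hproj i]
    fin_cases i
    · change ∫ y in {y : Plane | ∀ i, y i ∈ Ico (0 : ℝ) 1}, (1 - J⁻¹ * h y ^ 2) = 0
      rw [integral_sub (hintegrable _ continuous_const fun _ _ _ => rfl)
        ((hintegrable (fun y => h y ^ 2) (hsmooth.continuous.pow 2)
          fun y z hz => by simp only [hper y z hz]).const_mul _),
        integral_const_mul, ← hJ, inv_mul_cancel₀ hint2.ne']
      rw [setIntegral_const, measureReal_def, volume_unitSquare]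
      simp
    · exact hint0
  -- Either `h² ≥ J / 2`, and the second component is large, or `h² ≤ J / 2`, and the first is at
  -- least `1 / 2`.
  · refine ⟨min (1 / 2) (Real.sqrt (J / 2)), by positivity, fun y => ?_⟩
    have hn : ‖f y‖ = Real.sqrt ((1 - J⁻¹ * h y ^ 2) ^ 2 + h y ^ 2) := by
      rw [EuclideanSpace.norm_eq, Fin.sum_univ_two]
      simp [f]
    rw [hn]
    rcases le_total (J / 2) (h y ^ 2) with hle | hle
    · refine (min_le_right _ _).trans (Real.sqrt_le_sqrt ?_)
      nlinarith [sq_nonneg (1 - J⁻¹ * h y ^ 2)]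
    · refine (min_le_left _ _).trans (Real.le_sqrt_of_sq_le ?_)
      have : J⁻¹ * h y ^ 2 ≤ 1 / 2 := by
        rw [inv_mul_le_iff₀ hint2]
        linarith
      nlinarith [sq_nonneg (h y)]

/-! ### Global solvability of the damped second-order system -/

/-- Here `W = e^t V`, which turns the damped system into one with bounded forcing. After rescaling,
a single application of Picard–Lindelöf covers all of `[0, τ]`, without continuation. -/
theorem exists_solution_Icc {τ C B : ℝ} (hτ : 0 < τ) (hC : 0 ≤ C) (hB : 0 ≤ B) {L : NNReal}
    {f : Plane → Plane} (hf : LipschitzWith L f) (hfB : ∀ y, ‖f y‖ ≤ B) {c : ℝ → ℝ}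
    (hc : Continuous c) (hcC : ∀ t ∈ Icc 0 τ, |c t| ≤ C) (y w : Plane) :
    ∃ Y W : ℝ → Plane, Y 0 = y ∧ W 0 = w ∧ ∀ t ∈ Icc 0 τ,
      HasDerivWithinAt Y (Real.exp (-t) • W t) (Icc 0 τ) t ∧
      HasDerivWithinAt W (c t • f (Y t)) (Icc 0 τ) t := by
  -- The unknown `W` is rescaled so that the linear part has norm at most `1 / (2 * τ)`.
  let F : ℝ → Plane × Plane → Plane × Plane := fun t p =>
    ((Real.exp (-t) * (2 * τ)⁻¹) • p.2, (2 * τ * c t) • f p.1)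
  let z : Plane := (2 * τ) • w
  -- On the ball of radius `a` the speed must not exceed `a / τ`. The first component needs `(‖z‖ +
  -- a) / (2 τ) ≤ a / τ`, that is `‖z‖ ≤ a`; the second needs `2 τ C B ≤ a / τ`.
  obtain ⟨a, ha⟩ : ∃ a : NNReal, (a : ℝ) = ‖z‖ + 2 * τ * C * B * τ :=
    CanLift.prf _ (by positivity)
  obtain ⟨N, hN⟩ : ∃ N : NNReal, (N : ℝ) = a / τ := CanLift.prf _ (by positivity)
  obtain ⟨J, hJ⟩ : ∃ J : NNReal, (J : ℝ) = (2 * τ)⁻¹ + 2 * τ * C * L :=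
    CanLift.prf _ (by positivity)
  have hcoef : ∀ t ∈ Icc 0 τ, |Real.exp (-t) * (2 * τ)⁻¹| ≤ (2 * τ)⁻¹ := fun t ht => by
    rw [abs_of_pos (by positivity)]
    exact mul_le_of_le_one_left (by positivity) (Real.exp_le_one_iff.mpr (by linarith [ht.1]))
  have hcoef' : ∀ t ∈ Icc 0 τ, |2 * τ * c t| ≤ 2 * τ * C := fun t ht => by
    rw [abs_mul, abs_of_pos (by positivity : (0 : ℝ) < 2 * τ)]
    exact mul_le_mul_of_nonneg_left (hcC t ht) (by positivity)
  have hPL : IsPicardLindelof F (tmin := 0) (tmax := τ) ⟨0, le_rfl, hτ.le⟩ (y, z) a 0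
      N J := by
    refine ⟨fun t ht => ?_, fun p _ => ?_, fun t ht p hp => ?_, ?_⟩
    · refine LipschitzOnWith.of_dist_le_mul fun p _ q _ => ?_
      rw [hJ, Prod.dist_eq (x := F t p)]
      have h1 : dist p.2 q.2 ≤ dist p q := le_max_right _ _
      have h2 : dist p.1 q.1 ≤ dist p q := le_max_left _ _
      refine max_le ?_ ?_
      · rw [dist_smul₀, Real.norm_eq_abs]
        refine (mul_le_mul (hcoef t ht) h1 dist_nonneg (by positivity)).trans ?_
        exact mul_le_mul_of_nonneg_right (le_add_of_nonneg_right (by positivity)) dist_nonneg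
      · rw [dist_smul₀, Real.norm_eq_abs]
        refine (mul_le_mul (hcoef' t ht) ((hf.dist_le_mul _ _).trans
          (mul_le_mul_of_nonneg_left h2 L.coe_nonneg)) dist_nonneg (by positivity)).trans ?_
        rw [← mul_assoc]
        exact mul_le_mul_of_nonneg_right (le_add_of_nonneg_left (by positivity)) dist_nonneg
    · exact Continuous.continuousOn (by fun_prop)
    · rw [Prod.norm_def, hN]
      refine max_le ?_ ?_
      · have h1 : ‖p.2‖ ≤ ‖z‖ + a := by
          have h2 : ‖p.2 - z‖ ≤ a :=
            (norm_snd_le (p - (y, z))).trans (mem_closedBall_iff_norm.mp hp)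
          linarith [norm_le_norm_add_norm_sub' p.2 z]
        rw [norm_smul, Real.norm_eq_abs]
        refine (mul_le_mul (hcoef t ht) h1 (norm_nonneg _) (by positivity)).trans ?_
        rw [inv_mul_le_iff₀ (by positivity), mul_assoc, mul_div_cancel₀ _ hτ.ne']
        have : 0 ≤ 2 * τ * C * B * τ := by positivity
        linarith
      · rw [norm_smul, Real.norm_eq_abs]
        refine (mul_le_mul (hcoef' t ht) (hfB _) (norm_nonneg _) (by positivity)).trans ?_
        rw [le_div_iff₀ hτ, ha]
        exact le_add_of_nonneg_left (norm_nonneg _)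
    · simp only [sub_zero, NNReal.coe_zero]
      rw [hN, max_eq_left hτ.le, div_mul_cancel₀ _ hτ.ne']
  obtain ⟨p, hp0, hp⟩ := hPL.exists_eq_forall_mem_Icc_hasDerivWithinAt₀
  have hτ2 : 2 * τ ≠ 0 := by positivity
  refine ⟨fun t => (p t).1, fun t => (2 * τ)⁻¹ • (p t).2, by simp [hp0], ?_,
    fun t ht => ⟨?_, ?_⟩⟩
  · simp only [hp0, z, smul_smul, inv_mul_cancel₀ hτ2, one_smul]
  · refine ((ContinuousLinearMap.fst ℝ Plane Plane).hasFDerivAt.comp_hasDerivWithinAt t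
      (hp t ht)).congr_deriv ?_
    simp [F, smul_smul]
  · refine (((ContinuousLinearMap.snd ℝ Plane Plane).hasFDerivAt.comp_hasDerivWithinAt t
      (hp t ht)).const_smul (2 * τ)⁻¹).congr_deriv ?_
    simp only [F, ContinuousLinearMap.coe_snd', smul_smul]
    rw [inv_mul_cancel_left₀ hτ2]

/-! ### The effect of a short impulse -/

theorem norm_le_of_hasDerivWithinAt_Icc {E : Type*} [NormedAddCommGroup E] [NormedSpace ℝ E]
    {g g' : ℝ → E} {b b' : ℝ → ℝ} {τ : ℝ}
    (hg : ∀ t ∈ Icc 0 τ, HasDerivWithinAt g (g' t) (Icc 0 τ) t)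
    (hb : ∀ t, HasDerivAt b (b' t) t) (h0 : ‖g 0‖ ≤ b 0)
    (hle : ∀ t ∈ Icc 0 τ, ‖g' t‖ ≤ b' t) : ∀ t ∈ Icc 0 τ, ‖g t‖ ≤ b t :=
  fun _ ht => image_norm_le_of_norm_deriv_right_le_deriv_boundary
    (fun s hs => (hg s hs).continuousWithinAt)
    (fun s hs => (hg s ⟨hs.1, hs.2.le⟩).mono_of_mem_nhdsWithin
      (mem_nhdsGE_iff_exists_Icc_subset.mpr ⟨τ, hs.2, Icc_subset_Icc_left hs.1⟩))
    h0 hb (fun s hs => hle s ⟨hs.1, hs.2.le⟩) ht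

/-- The derivative of `Φ` is the time profile of the impulse: nonnegative, of total mass one however
small `T` is. Flatness up to `T / 2` keeps the support of the field away from time 0. -/
theorem exists_smooth_step {T : ℝ} (hT : 0 < T) :
    ∃ Φ : ℝ → ℝ, ContDiff ℝ ∞ Φ ∧ Monotone Φ ∧ (∀ t ≤ T / 2, Φ t = 0) ∧ ∀ t, T ≤ t → Φ t = 1 := by
  refine ⟨fun t => Real.smoothTransition (2 / T * t - 1),
    Real.smoothTransition.contDiff.comp ((contDiff_const.mul contDiff_id).sub contDiff_const),
    fun s t hst => Real.smoothTransition.monotone (by gcongr), fun t ht => ?_, fun t ht => ?_⟩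
  · apply Real.smoothTransition.zero_of_nonpos
    rw [sub_nonpos, div_mul_eq_mul_div, div_le_one hT]
    linarith
  · apply Real.smoothTransition.one_of_one_le
    rw [le_sub_iff_add_le, div_mul_eq_mul_div, le_div_iff₀ hT]
    linarith

section Impulse

variable {τ A B : ℝ} {f : Plane → Plane} {Φ : ℝ → ℝ} {Y V : ℝ → Plane}

/-- The integrating factor cancels both the damping and the weight `e^{-t}` built into the field. -/
theorem hasDerivWithinAt_exp_smul {s : Set ℝ} {t k : ℝ} {u : Plane}
    (hV : HasDerivWithinAt V (-V t + (Real.exp (-t) * k) • u) s t) :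
    HasDerivWithinAt (fun r => Real.exp r • V r) (k • u) s t := by
  refine ((Real.hasDerivAt_exp t).hasDerivWithinAt.smul hV).congr_deriv ?_
  rw [smul_add, smul_smul, ← mul_assoc, ← Real.exp_add, add_neg_cancel, Real.exp_zero, one_mul,
    smul_neg]
  abel

theorem norm_exp_smul_le (hA : 0 ≤ A) (hfB : ∀ y, ‖f y‖ ≤ B)
    (hΦ : Differentiable ℝ Φ) (hmono : Monotone Φ) (hΦ0 : Φ 0 = 0)
    (hV : ∀ t ∈ Icc 0 τ,
      HasDerivWithinAt V (-V t + (Real.exp (-t) * (A * deriv Φ t)) • f (Y t)) (Icc 0 τ) t) :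
    ∀ t ∈ Icc 0 τ, ‖Real.exp t • V t‖ ≤ ‖V 0‖ + A * B * Φ t := by
  refine norm_le_of_hasDerivWithinAt_Icc (fun t ht => hasDerivWithinAt_exp_smul (hV t ht))
    (fun t => ((hΦ t).hasDerivAt.const_mul (A * B)).const_add ‖V 0‖) (by simp [hΦ0])
    fun t _ => ?_
  have := hmono.deriv_nonneg (x := t)
  rw [norm_smul, Real.norm_eq_abs, abs_of_nonneg (by positivity), mul_right_comm A B]
  exact mul_le_mul_of_nonneg_left (hfB _) (by positivity)

/-- The bound does not involve the duration of the impulse, so `T` can be chosen after it. -/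
theorem norm_velocity_le (hA : 0 ≤ A) (hB : 0 ≤ B) (hfB : ∀ y, ‖f y‖ ≤ B)
    (hΦ : Differentiable ℝ Φ) (hmono : Monotone Φ) (hΦ0 : Φ 0 = 0) (hΦ1 : ∀ t, Φ t ≤ 1)
    (hV : ∀ t ∈ Icc 0 τ,
      HasDerivWithinAt V (-V t + (Real.exp (-t) * (A * deriv Φ t)) • f (Y t)) (Icc 0 τ) t) :
    ∀ t ∈ Icc 0 τ, ‖V t‖ ≤ ‖V 0‖ + A * B := by
  intro t ht
  have h := norm_exp_smul_le hA hfB hΦ hmono hΦ0 hV t ht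
  rw [norm_smul, Real.norm_eq_abs, Real.abs_exp] at h
  have h1 : 1 * ‖V t‖ ≤ Real.exp t * ‖V t‖ :=
    mul_le_mul_of_nonneg_right (Real.one_le_exp ht.1) (norm_nonneg _)
  have h2 : A * B * Φ t ≤ A * B := mul_le_of_le_one_right (by positivity) (hΦ1 t)
  linarith

theorem norm_displacement_le {K : ℝ}
    (hY : ∀ t ∈ Icc 0 τ, HasDerivWithinAt Y (V t) (Icc 0 τ) t)
    (hK : ∀ t ∈ Icc 0 τ, ‖V t‖ ≤ K) : ∀ t ∈ Icc 0 τ, ‖Y t - Y 0‖ ≤ K * t :=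
  norm_le_of_hasDerivWithinAt_Icc (g := fun t => Y t - Y 0)
    (fun t ht => (hY t ht).sub_const (Y 0))
    (fun t => by simpa using (hasDerivAt_id t).const_mul K) (by simp) hK

/-- After an impulse of duration `T` and total strength `A`, the velocity is `A • f` at the
initial position, up to the initial velocity and an error of order `T`. -/
theorem le_norm_exp_smul_of_impulse {K T m : ℝ} {L : NNReal} (hA : 0 ≤ A) (hK0 : 0 ≤ K)
    (hT : 0 ≤ T) (hTτ : T ≤ τ) (hf : LipschitzWith L f) (hm : ∀ y, m ≤ ‖f y‖)
    (hΦ : Differentiable ℝ Φ) (hmono : Monotone Φ) (hΦ0 : Φ 0 = 0) (hΦT : Φ T = 1)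
    (hY : ∀ t ∈ Icc 0 τ, HasDerivWithinAt Y (V t) (Icc 0 τ) t)
    (hK : ∀ t ∈ Icc 0 τ, ‖V t‖ ≤ K)
    (hV : ∀ t ∈ Icc 0 τ,
      HasDerivWithinAt V (-V t + (Real.exp (-t) * (A * deriv Φ t)) • f (Y t)) (Icc 0 τ) t) :
    A * m - ‖V 0‖ - A * (L * (K * T)) ≤ ‖Real.exp T • V T‖ := by
  have hsub : Icc 0 T ⊆ Icc 0 τ := Icc_subset_Icc_right hTτ
  -- Comparison with the impulse frozen at the initial position: the displacement is at most `K T`,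
  -- so the difference grows at rate at most `A L K T Φ'` from its initial norm `‖V 0‖`.
  have h := norm_le_of_hasDerivWithinAt_Icc (τ := T)
    (g := fun t => Real.exp t • V t - (A * Φ t) • f (Y 0))
    (g' := fun t => (A * deriv Φ t) • f (Y t) - (A * deriv Φ t) • f (Y 0))
    (b := fun t => ‖V 0‖ + A * (L * (K * T)) * Φ t)
    (b' := fun t => A * (L * (K * T)) * deriv Φ t)
    (fun t ht => ((hasDerivWithinAt_exp_smul (hV t (hsub ht))).mono hsub).sub
      (((hΦ t).hasDerivAt.const_mul A).smul_const (f (Y 0))).hasDerivWithinAt)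
    (fun t => ((hΦ t).hasDerivAt.const_mul _).const_add _) (by simp [hΦ0])
    (fun t ht => by
      have h0 := hmono.deriv_nonneg (x := t)
      have h1 : ‖f (Y t) - f (Y 0)‖ ≤ L * (K * T) :=
        (hf.norm_sub_le _ _).trans (mul_le_mul_of_nonneg_left
          ((norm_displacement_le hY hK t (hsub ht)).trans
            (mul_le_mul_of_nonneg_left ht.2 hK0)) L.coe_nonneg)
      rw [← smul_sub, norm_smul, Real.norm_eq_abs, abs_of_nonneg (by positivity),
        mul_right_comm A (L * (K * T) : ℝ)]
      exact mul_le_mul_of_nonneg_left h1 (by positivity))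
    T ⟨hT, le_rfl⟩
  rw [hΦT, mul_one, mul_one] at h
  have h1 := norm_sub_norm_le (A • f (Y 0)) (Real.exp T • V T)
  rw [norm_sub_rev, norm_smul, Real.norm_eq_abs, abs_of_nonneg hA] at h1
  have h2 := mul_le_mul_of_nonneg_left (hm (Y 0)) hA
  linarith

end Impulse

/-! ### Choice of the constants and verification of the field. -/

theorem curl_eq_zero_of_eventuallyEq_const {W : Torus → Plane} {y w : Plane}
    (h : (fun z : Plane => W (z : Torus)) =ᶠ[nhds y] fun _ => w) : curl W y = 0 := by
  simp [curl, h.fderiv_eq]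

end LowVelocities

theorem mainTheorem3 (τ M : ℝ) (hτ : 0 < τ) (hM : 0 < M)
    (x₀ : LowVelocities.Torus) (r₀ : ℝ) (hr₀ : 0 < r₀) :
    ∃ U : ℝ → LowVelocities.Torus → LowVelocities.Plane,
      LowVelocities.SmoothField τ U ∧
      (∀ t ∈ Set.Icc 0 τ, ∀ y : LowVelocities.Plane,
        (y : LowVelocities.Torus) ∉ Metric.closedBall x₀ r₀ → LowVelocities.curl (U t) y = 0) ∧
      LowVelocities.spaceTimeSupport τ U ⊆ Set.Ioo 0 τ ×ˢ Set.univ ∧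
      (∀ t ∈ Set.Icc 0 τ, LowVelocities.torusIntegral (U t) = 0) ∧
      ∃ Mbar : ℝ, 0 < Mbar ∧
        ∀ (x : LowVelocities.Torus) (v : LowVelocities.Plane), ‖v‖ < M →
          (∃ (X : ℝ → LowVelocities.Torus) (V : ℝ → LowVelocities.Plane),
            LowVelocities.IsCharacteristic τ U x v X V) ∧
          ∀ (X : ℝ → LowVelocities.Torus) (V : ℝ → LowVelocities.Plane),
            LowVelocities.IsCharacteristic τ U x v X V →
              ∃ t ∈ Set.Ioo 0 τ, M + 1 ≤ ‖V t‖ ∧ ‖V t‖ < Mbar := by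
  open LowVelocities in
  obtain ⟨f, hf, hfper, hfout, hfint, m, hm, hfm⟩ := exists_nonvanishing_field x₀ r₀ hr₀
  obtain ⟨B, hB, hfB⟩ := exists_bound_of_continuous_of_periodic hf.continuous hfper
  obtain ⟨L, hL⟩ := exists_lipschitzWith_of_periodic hf hfper
  -- In `A m`, the term `e^τ (M + 1)` pays for the factor `e^T`, the term `M` for the initial
  -- velocity and the term 1 for the freezing error.
  set A := (Real.exp τ * (M + 1) + M + 1) / m with hAdef
  have hA : 0 < A := by positivity
  set K := M + A * B with hKdef
  have hK : 0 < K := by positivity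
  -- The first bound gives `T < τ`, the second a freezing error `A L K T ≤ 1`; the added 1 covers
  -- the case `L = 0`.
  set T := min (τ / 2) (A * (L * K) + 1)⁻¹ with hTdef
  have hT : 0 < T := by positivity
  have hTτ : T < τ := (min_le_left _ _).trans_lt (by linarith)
  have hTsmall : A * (L * (K * T)) ≤ 1 := by
    have h1 : T ≤ (A * (L * K) + 1)⁻¹ := min_le_right _ _
    have h2 := mul_le_mul_of_nonneg_left h1 (by positivity : 0 ≤ A * (L * K) + 1)
    rw [mul_inv_cancel₀ (by positivity)] at h2
    linarith
  obtain ⟨Φ, hΦ, hmono, hΦ0, hΦ1⟩ := exists_smooth_step hT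
  have hΦz : Φ 0 = 0 := hΦ0 0 (by positivity)
  have hΦdiff : Differentiable ℝ Φ := hΦ.differentiable (by simp)
  have hΦle : ∀ t, Φ t ≤ 1 := fun t =>
    (hmono (le_max_left t T)).trans_eq (hΦ1 _ (le_max_right t T))
  have hΦ' : ContDiff ℝ ∞ (deriv Φ) := (contDiff_infty_iff_deriv.mp hΦ).2
  have hsupp : ∀ t, deriv Φ t ≠ 0 → t ∈ Icc (T / 2) T := by
    intro t ht
    by_contra hcon
    rw [mem_Icc, not_and_or, not_le, not_le] at hcon
    apply ht
    rcases hcon with h | h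
    · have : Φ =ᶠ[nhds t] fun _ => 0 :=
        Filter.eventually_of_mem (Iio_mem_nhds h) fun s hs => hΦ0 s (le_of_lt hs)
      rw [this.deriv_eq, deriv_const]
    · have : Φ =ᶠ[nhds t] fun _ => 1 :=
        Filter.eventually_of_mem (Ioi_mem_nhds h) fun s hs => hΦ1 s (le_of_lt hs)
      rw [this.deriv_eq, deriv_const]
  refine ⟨fun t q => (Real.exp (-t) * (A * deriv Φ t)) • descend f hfper q, ?_, ?_, ?_, ?_,
    K + 1, by positivity, fun x v hv => ⟨?_, ?_⟩⟩
  · refine ContDiff.contDiffOn ?_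
    simp only [descend_coe]
    exact ((Real.contDiff_exp.comp contDiff_fst.neg).mul
      (contDiff_const.mul (hΦ'.comp contDiff_fst))).smul (hf.comp contDiff_snd)
  · intro t _ y hy
    refine curl_eq_zero_of_eventuallyEq_const
      (w := (Real.exp (-t) * (A * deriv Φ t)) • EuclideanSpace.single 0 1) ?_
    have hclosed : IsClosed (Metric.closedBall x₀ r₀) := Metric.isClosed_closedBall
    have hopen : IsOpen {z : Plane | (z : Torus) ∉ Metric.closedBall x₀ r₀} :=
      hclosed.isOpen_compl.preimage QuotientAddGroup.continuous_mk
    filter_upwards [hopen.mem_nhds hy] with z hz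
    rw [descend_coe, hfout z hz]
  · refine (closure_minimal (t := Icc (T / 2) T ×ˢ univ) ?_ (isClosed_Icc.prod isClosed_univ)).trans
      (prod_mono (Icc_subset_Ioo (by positivity) hTτ) le_rfl)
    rintro ⟨t, q⟩ ⟨-, h⟩
    refine ⟨hsupp t fun h0 => h ?_, mem_univ _⟩
    simp [h0]
  · intro t _
    simp only [LowVelocities.torusIntegral, descend_coe]
    rw [integral_smul, hfint, smul_zero]
  · obtain ⟨y, rfl⟩ := QuotientAddGroup.mk_surjective x
    have hc : Continuous fun t => A * deriv Φ t := continuous_const.mul hΦ'.continuous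
    obtain ⟨C, hC⟩ := isCompact_Icc.exists_bound_of_continuousOn (s := Icc 0 τ) hc.continuousOn
    have hC0 : 0 ≤ C := (norm_nonneg _).trans (hC 0 ⟨le_rfl, hτ.le⟩)
    -- The velocity is recovered as `V = e^{-t} W`.
    obtain ⟨Y, W, hY0, hW0, h⟩ := exists_solution_Icc hτ hC0 hB.le hL hfB hc hC y v
    refine ⟨fun t => (Y t : Torus), fun t => Real.exp (-t) • W t, by simp [hY0], by simp [hW0],
      ⟨Y, fun t ht => ⟨rfl, (h t ht).1⟩⟩, fun t ht => ?_⟩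
    have hexp : HasDerivAt (fun s : ℝ => Real.exp (-s)) (-Real.exp (-t)) t := by
      simpa using (hasDerivAt_neg t).exp
    refine (hexp.hasDerivWithinAt.smul (h t ht).2).congr_deriv ?_
    simp only [descend_coe, smul_smul, neg_smul, add_comm]
  · rintro X V ⟨-, rfl, ⟨Y, hY⟩, hV⟩
    have hV' : ∀ t ∈ Icc 0 τ, HasDerivWithinAt V
        (-V t + (Real.exp (-t) * (A * deriv Φ t)) • f (Y t)) (Icc 0 τ) t := fun t ht => by
      simpa only [← (hY t ht).1, descend_coe] using hV t ht
    have hVK : ∀ t ∈ Icc 0 τ, ‖V t‖ ≤ K := fun t ht =>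
      (norm_velocity_le hA.le hB.le hfB hΦdiff hmono hΦz hΦle hV' t ht).trans (by linarith)
    -- The same time, the end of the impulse, works for all initial data and all solutions.
    refine ⟨T, ⟨hT, hTτ⟩, ?_, by linarith [hVK T ⟨hT.le, hTτ.le⟩]⟩
    have h := le_norm_exp_smul_of_impulse hA.le hK.le hT.le hTτ.le hL hfm hΦdiff hmono hΦz
      (hΦ1 T le_rfl) (fun t ht => (hY t ht).2) hVK hV'
    rw [hAdef, div_mul_cancel₀ _ hm.ne', ← hAdef, norm_smul, Real.norm_eq_abs, Real.abs_exp] at h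
    have h1 : Real.exp T * (M + 1) ≤ Real.exp τ * (M + 1) :=
      mul_le_mul_of_nonneg_right (Real.exp_le_exp.mpr hTτ.le) (by positivity)
    exact le_of_mul_le_mul_left (by linarith) (Real.exp_pos T)
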